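/- Let $S$ be a finite set of $n>3$ points in the Euclidean plane in general position, meaning that no three points of $S$ are collinear and no four are cocircular. For $1\le k\le n-1$ let $v_k$ be the number of vertices of the order-$k$ Voronoi diagram of $S$ (the subdivision of the plane into cells, where points in the same cell have the same $k$ nearest points of $S$; a vertex is a point in which at least three cells meet), and let $p_V(z)=\sum_{k=1}^{n-1}v_k z^{k-1}$ be the Voronoi polynomial of $S$. Let $\overline{cr}(S)$ be the rectilinear crossing number of $S$, i.e. the number of pairs of edges that cross in the straight-line drawing of the complete graph with vertex set $S$, and write $\overline{cr}(S)=\alpha\binom n4$. Then $p_V$ has a complex root of modulus at least $$1+\frac{(1-\alpha)\pi^2}{16(n-3)^2}+O\!\left(\frac1{n^4}\right).$$ That is, there is an absolute constant $K$ such that for every $n>3$ and every such $S$, the polynomial $p_V$ is nonzero and has a root $z\in\mathbb C$ with $|z|\ge 1+\frac{(1-\alpha)\pi^2}{16(n-3)^2}-\frac{K}{n^4}$. -/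

import Mathlib

/-- The Euclidean plane. -/
abbrev Plane : Type := EuclideanSpace ℝ (Fin 2)

/-- A finite planar point set is in general position if no three of its points are collinear
and no four of its points are cocircular. -/
def InGeneralPosition (S : Finset Plane) : Prop :=
  (∀ T ⊆ S, T.card = 3 → ¬ Collinear ℝ (T : Set Plane)) ∧
  (∀ T ⊆ S, T.card = 4 → ¬ EuclideanGeometry.Cospherical (T : Set Plane))

/-- The (closed) cell of `A ⊆ S` in the Voronoi diagram of `S` of order `A.card`: the points `x`
of the plane for which `A` is a set of `A.card` nearest points of `S`. -/
def voronoiCell (S A : Finset Plane) : Set Plane :=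
  {x | ∀ a ∈ A, ∀ b ∈ S, b ∉ A → dist x a ≤ dist x b}

open Classical in
/-- The vertices of the order-`k` Voronoi diagram of `S`: the points of the plane in which at
least three different cells of the diagram meet. -/
noncomputable def voronoiVertices (S : Finset Plane) (k : ℕ) : Set Plane :=
  {x | 3 ≤ ((S.powersetCard k).filter (fun A => x ∈ voronoiCell S A)).card}

/-- The Voronoi polynomial `∑_{k=1}^{n-1} v_k z^{k-1}`, where `n` is the number of points of `S`
and `v_k` is the number of vertices of the order-`k` Voronoi diagram of `S`. -/
noncomputable def voronoiPolynomial (S : Finset Plane) : Polynomial ℂ :=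
  ∑ k ∈ Finset.Icc 1 (S.card - 1),
    Polynomial.C (((voronoiVertices S k).ncard : ℕ) : ℂ) * Polynomial.X ^ (k - 1)

open Classical in
/-- The rectilinear crossing number of `S`: the number of unordered pairs of distinct edges of
the straight-line drawing of the complete graph on `S` that cross, that is, whose relative
interiors have a common point. Edges are two-element subsets of `S`. -/
noncomputable def rectilinearCrossingNumber (S : Finset Plane) : ℕ :=
  (((S.powersetCard 2).powersetCard 2).filter (fun P =>
    ∃ a b c d : Plane, P = {{a, b}, {c, d}} ∧
      (openSegment ℝ a b ∩ openSegment ℝ c d).Nonempty)).card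

/-! By general position, every Voronoi vertex is the centre of a circle through exactly three
points, and a circle enclosing `e` points gives a vertex in orders `e + 1` and `e + 2` only. Hence
`p_V = (1 + z) C(z)` with `C(z) = ∑ z ^ e` over all triples, of degree `d = n - 3`
(`voronoiPolynomial_eq`, `natDegree_circlePolynomial`).

Here `C(1) = n.choose 3`, while `C'(1)` counts pairs of a quadruple and one of its points inside the
circle through the other three. A quadruple gives at most one such pair, or two if it yields a
crossing, so `C'(1) ≤ (1 + α) (n.choose 4) = (1 + α) / 4 * d * C(1)` (`sum_enclosedCard_le`).

Since `C'(1) / C(1) = ∑ 1 / (1 - z)` over the `d` roots, some root has `Re (1 / (1 - z)) ≤ (1 + α) /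
4`, which for `α < 1` means `|z|² - 1 ≥ (1 - α) / 2 * |1 - z|²`. Nonnegative coefficients keep the
roots out of a sector around the positive axis, so for `d ≥ 2` they stay at distance at least `2 /
d` from `1` (`exists_root_norm_ge`). -/

/-! ### Roots of polynomials with nonnegative coefficients -/

open Polynomial in
/-- A real polynomial of degree `d` with nonnegative coefficients has no zero in the open sector
`|arg z| < π / d`. -/
theorem pi_div_natDegree_le_abs_arg {P : ℝ[X]} (h0 : ∀ k, 0 ≤ P.coeff k) (hd : 0 < P.natDegree)
    {z : ℂ} (hz : z ≠ 0) (hPz : (P.map (algebraMap ℝ ℂ)).eval z = 0) :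
    Real.pi / P.natDegree ≤ |z.arg| := by
  have hd' : (0 : ℝ) < P.natDegree := by exact_mod_cast hd
  have key : ∀ w : ℂ, w ≠ 0 → 0 ≤ w.arg → (P.map (algebraMap ℝ ℂ)).eval w = 0 →
      Real.pi / P.natDegree ≤ w.arg := by
    intro w hw hw0 hPw
    by_contra! hlt
    have hsum : ∑ k ∈ Finset.range (P.natDegree + 1),
        ((P.coeff k * ‖w‖ ^ k : ℝ) : ℂ) * Complex.exp ((k * w.arg : ℝ) * Complex.I) = 0 := by
      rw [← hPw, eval_map, eval₂_eq_sum_range]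
      refine Finset.sum_congr rfl fun k _ => ?_
      conv_rhs => rw [← Complex.norm_mul_exp_arg_mul_I w]
      rw [mul_pow, ← Complex.exp_nat_mul]
      push_cast
      rw [Complex.coe_algebraMap]
      ring_nf
    have hlead : 0 < P.coeff P.natDegree * ‖w‖ ^ P.natDegree := by
      refine mul_pos (lt_of_le_of_ne (h0 _) fun h => ?_) (pow_pos (norm_pos_iff.2 hw) _)
      have : P = 0 := leadingCoeff_eq_zero.1 h.symm
      simp [this] at hd
    -- On the positive axis the imaginary parts vanish, so real parts are compared; elsewhere in the
    -- sector every `sin (k * w.arg)` with `k ≤ d` is nonnegative, and the leading one is positive.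
    rcases hw0.eq_or_lt with h | hpos
    · have := congrArg Complex.re hsum
      simp only [← h, mul_zero, Complex.ofReal_zero, zero_mul, Complex.exp_zero, mul_one,
        Complex.re_sum, Complex.ofReal_re, Complex.zero_re] at this
      rw [Finset.sum_eq_zero_iff_of_nonneg
        (fun k _ => mul_nonneg (h0 k) (pow_nonneg (norm_nonneg _) _))] at this
      exact hlead.ne' (this _ (by simp))
    · have := congrArg Complex.im hsum
      simp only [Complex.im_sum, Complex.im_ofReal_mul, Complex.exp_ofReal_mul_I_im,
        Complex.zero_im] at this
      have hmul : P.natDegree * w.arg < Real.pi := by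
        rwa [lt_div_iff₀ hd', mul_comm] at hlt
      have hk : ∀ k ∈ Finset.range (P.natDegree + 1),
          0 ≤ P.coeff k * ‖w‖ ^ k * Real.sin (k * w.arg) := by
        intro k hk
        have hkd : (k : ℝ) ≤ P.natDegree := by
          exact_mod_cast Nat.lt_succ_iff.1 (Finset.mem_range.1 hk)
        refine mul_nonneg (mul_nonneg (h0 k) (pow_nonneg (norm_nonneg _) _))
          (Real.sin_nonneg_of_nonneg_of_le_pi (by positivity) ?_)
        exact (mul_le_mul_of_nonneg_right hkd hw0).trans hmul.le
      rw [Finset.sum_eq_zero_iff_of_nonneg hk] at this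
      refine (mul_pos hlead (Real.sin_pos_of_pos_of_lt_pi (by positivity) hmul)).ne'
        (this _ (by simp))
  rcases le_total 0 z.arg with h | h
  · rw [abs_of_nonneg h]
    exact key z hz h hPz
  · have hne : z.arg ≠ Real.pi := fun h' => by linarith [Real.pi_pos]
    have hc : (starRingEnd ℂ z).arg = -z.arg := by rw [Complex.arg_conj, if_neg hne]
    rw [abs_of_nonpos h, ← hc]
    refine key _ (by simpa using hz) (by rw [hc]; linarith) ?_
    rw [eval_map_algebraMap] at hPz ⊢
    rw [aeval_conj, hPz, map_zero]

/-- The distance from `1` to a point outside the sector `|arg z| < θ`. -/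
theorem sin_sq_le_norm_one_sub_sq {z : ℂ} {θ : ℝ} (h0 : 0 ≤ θ) (h : θ ≤ |z.arg|) :
    Real.sin θ ^ 2 ≤ ‖1 - z‖ ^ 2 := by
  have hcos : Real.cos z.arg ≤ Real.cos θ := by
    rw [← Real.cos_abs z.arg]
    exact Real.cos_le_cos_of_nonneg_of_le_pi h0 (Complex.abs_arg_le_pi z) h
  have h1 : ‖1 - z‖ ^ 2 = 1 - 2 * (‖z‖ * Real.cos z.arg) + ‖z‖ ^ 2 := by
    rw [Complex.norm_mul_cos_arg, ← Complex.normSq_eq_norm_sq, ← Complex.normSq_eq_norm_sq,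
      Complex.normSq_apply, Complex.normSq_apply]
    simp
    ring
  have h2 := mul_le_mul_of_nonneg_left hcos (norm_nonneg z)
  rw [h1, Real.sin_sq]
  -- `1 - 2 r cos θ + r² = sin² θ + (r - cos θ)²`.
  nlinarith [sq_nonneg (‖z‖ - Real.cos θ)]

/-- The map `z ↦ 1 / (1 - z)` sends the unit circle to the line `Re = 1 / 2`; a real part below `1 /
2` therefore detects a root outside the disk. -/
theorem re_one_div_one_sub {z : ℂ} (hz : z ≠ 1) :
    (1 / (1 - z)).re = 1 / 2 - (‖z‖ ^ 2 - 1) / (2 * ‖1 - z‖ ^ 2) := by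
  have h : 0 < ‖1 - z‖ ^ 2 := by
    have : 1 - z ≠ 0 := sub_ne_zero.2 hz.symm
    positivity
  have h1 : ‖1 - z‖ ^ 2 = 1 - 2 * z.re + ‖z‖ ^ 2 := by
    rw [← Complex.normSq_eq_norm_sq, ← Complex.normSq_eq_norm_sq,
      Complex.normSq_apply, Complex.normSq_apply]
    simp
    ring
  have h2 : (1 - z).re = (‖1 - z‖ ^ 2 - (‖z‖ ^ 2 - 1)) / 2 := by
    rw [h1, Complex.sub_re, Complex.one_re]
    ring
  rw [one_div, Complex.inv_re, Complex.normSq_eq_norm_sq, h2]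
  field_simp
  rw [sub_div, div_self h.ne']

open Polynomial in
/-- A polynomial of degree `d ≥ 2` with nonnegative coefficients whose logarithmic derivative at
`1` is at most `d (1 + α) / 4` has a root well outside the unit disk. -/
theorem exists_root_norm_ge {P : ℝ[X]} {α : ℝ} (h0 : ∀ k, 0 ≤ P.coeff k) (hd : 2 ≤ P.natDegree)
    (hα0 : 0 ≤ α) (hα1 : α < 1) (h1 : 0 < P.eval 1)
    (hder : P.derivative.eval 1 ≤ (1 + α) / 4 * P.natDegree * P.eval 1) :
    ∃ z ∈ (P.map (algebraMap ℝ ℂ)).roots,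
      1 + (1 - α) * Real.pi ^ 2 / (16 * (P.natDegree : ℝ) ^ 2) ≤ ‖z‖ := by
  set d := P.natDegree with hdd
  have hd' : (2 : ℝ) ≤ d := by exact_mod_cast hd
  set Q := P.map (algebraMap ℝ ℂ) with hQ
  have hQ1 : Q.eval 1 = ((P.eval 1 : ℝ) : ℂ) := by
    rw [hQ, eval_map_algebraMap, ← map_one (algebraMap ℝ ℂ), aeval_algebraMap_apply]
    simp
  have hQ1' : Q.derivative.eval 1 = ((P.derivative.eval 1 : ℝ) : ℂ) := by
    rw [hQ, derivative_map, eval_map_algebraMap, ← map_one (algebraMap ℝ ℂ),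
      aeval_algebraMap_apply]
    simp
  have hQ0 : Q.eval 1 ≠ 0 := by
    rw [hQ1]
    exact_mod_cast h1.ne'
  have hlog := (IsAlgClosed.splits Q).eval_derivative_div_eval_of_ne_zero hQ0
  have hcard : Q.roots.card = d := by
    rw [← (IsAlgClosed.splits Q).natDegree_eq_card_roots, hQ, natDegree_map]
  by_contra! hlt
  set ε := (1 - α) * Real.pi ^ 2 / (16 * (d : ℝ) ^ 2) with hε
  have hpi : Real.pi ^ 2 < 10 := by nlinarith [Real.pi_lt_d2, Real.pi_pos]
  have hε0 : 0 < ε := by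
    have : 0 < 1 - α := by linarith
    positivity
  -- From `π² < 10`. Since `ε ≤ 1`, this leaves `2ε + ε² ≤ 3ε` below `2 (1 - α) / d²`.
  have hε1 : ε ≤ 5 / 8 * (1 - α) / (d : ℝ) ^ 2 := by
    rw [hε, div_le_div_iff₀ (by positivity) (by positivity)]
    have : 0 ≤ (1 - α) * (d : ℝ) ^ 2 := mul_nonneg (by linarith) (by positivity)
    nlinarith
  have hε2 : ε ≤ 1 := by
    refine hε1.trans ?_
    rw [div_le_one (by positivity)]
    nlinarith
  have hmain : ∀ z ∈ Q.roots, (1 + α) / 4 < (1 / (1 - z)).re := by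
    intro z hz
    have hPz : Q.eval z = 0 := (mem_roots'.1 hz).2
    have hz1 : z ≠ 1 := by
      rintro rfl
      exact hQ0 hPz
    have hdist : 4 / (d : ℝ) ^ 2 ≤ ‖1 - z‖ ^ 2 := by
      -- The sector bound says nothing about `0`, whose distance to `1` suffices because `d ≥ 2`.
      by_cases hz0 : z = 0
      · rw [hz0, div_le_iff₀ (by positivity)]
        simp
        nlinarith
      · have harg := pi_div_natDegree_le_abs_arg h0 (by omega) hz0 hPz
        rw [← hdd] at harg
        have hs := sin_sq_le_norm_one_sub_sq (by positivity) harg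
        refine le_trans ?_ hs
        -- Jordan's inequality, valid since `d ≥ 2` gives `π / d ≤ π / 2`.
        have h2 := Real.mul_le_sin (x := Real.pi / d) (by positivity)
          (div_le_div_of_nonneg_left Real.pi_pos.le (by norm_num) hd')
        have h3 : 2 / Real.pi * (Real.pi / d) = 2 / (d : ℝ) := by field_simp
        rw [h3] at h2
        calc 4 / (d : ℝ) ^ 2 = (2 / (d : ℝ)) ^ 2 := by ring
          _ ≤ _ := pow_le_pow_left₀ (by positivity) h2 2
    have hn := hlt z hz
    have hpos : 0 < ‖1 - z‖ ^ 2 := lt_of_lt_of_le (by positivity) hdist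
    have hnum : ‖z‖ ^ 2 - 1 < (1 - α) / 2 * ‖1 - z‖ ^ 2 := by
      have ha : ‖z‖ ^ 2 < (1 + ε) ^ 2 := pow_lt_pow_left₀ hn (norm_nonneg _) two_ne_zero
      have hb : (1 - α) / 2 * (4 / (d : ℝ) ^ 2) ≤ (1 - α) / 2 * ‖1 - z‖ ^ 2 :=
        mul_le_mul_of_nonneg_left hdist (by linarith)
      have hc : (1 - α) / 2 * (4 / (d : ℝ) ^ 2) = 16 / 5 * (5 / 8 * (1 - α) / (d : ℝ) ^ 2) := by
        ring
      nlinarith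
    rw [re_one_div_one_sub hz1]
    have : (‖z‖ ^ 2 - 1) / (2 * ‖1 - z‖ ^ 2) < (1 - α) / 4 := by
      rw [div_lt_iff₀ (by positivity)]
      linarith
    linarith
  have hne : Q.roots ≠ 0 := by
    intro h
    rw [h] at hcard
    simp at hcard
    omega
  have hsum : (Q.roots.map fun _ => (1 + α) / 4).sum <
      (Q.roots.map fun z => (1 / (1 - z)).re).sum :=
    Multiset.sum_lt_sum_of_nonempty hne hmain
  have hre : (Q.roots.map fun z => (1 / (1 - z)).re).sum = P.derivative.eval 1 / P.eval 1 := by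
    have := congrArg Complex.reAddGroupHom hlog
    rw [map_multiset_sum, Multiset.map_map, hQ1, hQ1', ← Complex.ofReal_div] at this
    simpa using this.symm
  rw [hre, Multiset.map_const', Multiset.sum_replicate, hcard, nsmul_eq_mul,
    lt_div_iff₀ h1] at hsum
  nlinarith

/-! ### Circumcircles and general position -/

open EuclideanGeometry in
/-- A sphere through all points of `T`; for three points of the plane that are not collinear it is
their circumcircle. -/
noncomputable def circumcircle (T : Finset Plane) : Sphere Plane :=
  haveI : Nonempty (Sphere Plane) := ⟨⟨0, 0⟩⟩
  Classical.epsilon fun s : Sphere Plane => (T : Set Plane) ⊆ s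

open EuclideanGeometry in
theorem existsUnique_sphere {T : Finset Plane} (hT : T.card = 3)
    (hc : ¬ Collinear ℝ (T : Set Plane)) : ∃! s : Sphere Plane, (T : Set Plane) ⊆ s := by
  classical
  obtain ⟨a, b, c, -, -, -, rfl⟩ := Finset.card_eq_three.1 hT
  have hcoe : ((({a, b, c} : Finset Plane)) : Set Plane) = Set.range ![a, b, c] := by
    ext x
    simp
    tauto
  rw [hcoe] at hc ⊢
  have hi := affineIndependent_iff_not_collinear.2 hc
  have htop : affineSpan ℝ (Set.range ![a, b, c]) = ⊤ := by
    rw [hi.affineSpan_eq_top_iff_card_eq_finrank_add_one]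
    simp
  simpa only [htop, AffineSubspace.mem_top, true_and] using hi.existsUnique_dist_eq

theorem dist_circumcircle {T : Finset Plane} (hT : T.card = 3)
    (hc : ¬ Collinear ℝ (T : Set Plane)) {p : Plane} (hp : p ∈ T) :
    dist p (circumcircle T).center = (circumcircle T).radius := by
  have := Classical.epsilon_spec (existsUnique_sphere hT hc).exists
  exact this (Finset.mem_coe.2 hp)

theorem eq_circumcircle {T : Finset Plane} (hT : T.card = 3)
    (hc : ¬ Collinear ℝ (T : Set Plane)) {x : Plane} {r : ℝ} (h : ∀ p ∈ T, dist p x = r) :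
    circumcircle T = ⟨x, r⟩ :=
  (existsUnique_sphere hT hc).unique
    (fun _ hp => dist_circumcircle hT hc (Finset.mem_coe.1 hp)) fun p hp => h p hp

theorem InGeneralPosition.not_collinear {S T : Finset Plane} (hS : InGeneralPosition S)
    (hT : T ∈ S.powersetCard 3) : ¬ Collinear ℝ (T : Set Plane) :=
  hS.1 T (Finset.mem_powersetCard.1 hT).1 (Finset.mem_powersetCard.1 hT).2

theorem InGeneralPosition.card_filter_dist_eq_le {S : Finset Plane} (hS : InGeneralPosition S)
    (x : Plane) (r : ℝ) : (S.filter fun p => dist p x = r).card ≤ 3 := by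
  by_contra! h
  obtain ⟨Q, hQ, hQ4⟩ := Finset.exists_subset_card_eq (n := 4) h
  refine hS.2 Q (hQ.trans (Finset.filter_subset _ _)) hQ4 ⟨x, r, fun p hp => ?_⟩
  exact (Finset.mem_filter.1 (hQ (Finset.mem_coe.1 hp))).2

theorem collinear_of_inner_eq_zero {s : Set Plane} {a n : Plane} (ha : a ∈ s) (hn : n ≠ 0)
    (h : ∀ p ∈ s, inner ℝ n (p - a) = 0) : Collinear ℝ s := by
  rw [collinear_iff_of_mem ha]
  -- The direction of the line is the normal turned by a right angle.
  refine ⟨!₂[-n 1, n 0], fun p hp => ?_⟩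
  have h1 := h p hp
  have h2 : n 0 ^ 2 + n 1 ^ 2 ≠ 0 := by
    intro h0
    apply hn
    ext i
    fin_cases i
    · simp; nlinarith [sq_nonneg (n 0), sq_nonneg (n 1)]
    · simp; nlinarith [sq_nonneg (n 0), sq_nonneg (n 1)]
  simp only [PiLp.inner_apply, Fin.sum_univ_two, PiLp.sub_apply, RCLike.inner_apply,
    conj_trivial] at h1
  refine ⟨(n 0 * (p 1 - a 1) - n 1 * (p 0 - a 0)) / (n 0 ^ 2 + n 1 ^ 2), ?_⟩
  ext i
  fin_cases i
  · simp
    field_simp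
    linear_combination n 0 * h1
  · simp
    field_simp
    linear_combination n 1 * h1

/-! ### A circle through three points enclosing the whole set -/

/-- A finite system of affine inequalities in one variable that is feasible and not constant has a
solution at which one of the nonconstant inequalities is tight. -/
theorem exists_tight {ι : Type*} (s : Finset ι) (A B : ι → ℝ) (t₀ : ℝ)
    (h : ∀ i ∈ s, A i + B i * t₀ ≤ 0) (hB : ∃ i ∈ s, B i ≠ 0) :
    ∃ t, (∀ i ∈ s, A i + B i * t ≤ 0) ∧ ∃ i ∈ s, B i ≠ 0 ∧ A i + B i * t = 0 := by
  have key : ∀ (B : ι → ℝ) (t₀ : ℝ), (∀ i ∈ s, A i + B i * t₀ ≤ 0) → (∃ i ∈ s, 0 < B i) →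
      ∃ t, (∀ i ∈ s, A i + B i * t ≤ 0) ∧ ∃ i ∈ s, B i ≠ 0 ∧ A i + B i * t = 0 := by
    intro B t₀ h hB
    obtain ⟨i, hi, hmin⟩ := (s.filter fun i => 0 < B i).exists_min_image (fun i => -A i / B i)
      (by obtain ⟨i, hi, hiB⟩ := hB; exact ⟨i, by simp [hi, hiB]⟩)
    rw [Finset.mem_filter] at hi
    -- Increasing `t` from `t₀` only relaxes the nonincreasing constraints, so the first increasing
    -- one to become tight gives the solution.
    refine ⟨-A i / B i, fun j hj => ?_, i, hi.1, hi.2.ne', ?_⟩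
    · rcases lt_or_ge 0 (B j) with hBj | hBj
      · have := hmin j (by simp [hj, hBj])
        rw [le_div_iff₀ hBj] at this
        linarith
      · have h1 : t₀ ≤ -A i / B i := by
          rw [le_div_iff₀ hi.2]
          linarith [h i hi.1]
        nlinarith [h j hj]
    · have := hi.2.ne'
      field_simp
      ring
  obtain ⟨i, hi, hiB⟩ := hB
  rcases hiB.lt_or_gt with hneg | hpos
  · obtain ⟨t, ht, j, hj, hjB, hjt⟩ := key (fun i => -B i) (-t₀)
      (fun j hj => by simpa using h j hj) ⟨i, hi, by simpa using hneg⟩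
    exact ⟨-t, fun j hj => by simpa using ht j hj, j, hj, by simpa using hjB, by simpa using hjt⟩
  · exact key B t₀ h ⟨i, hi, hpos⟩

/-- For circles through `a`, enclosing `p` is an affine condition on the centre, so `exists_tight`
applies. -/
theorem dist_sq_sub_dist_sq (p a u : Plane) :
    dist p (a + u) ^ 2 - dist a (a + u) ^ 2 = ‖p - a‖ ^ 2 - 2 * inner ℝ u (p - a) := by
  have h1 : dist p (a + u) = ‖(p - a) - u‖ := by rw [dist_eq_norm]; congr 1; abel
  have h2 : dist a (a + u) = ‖u‖ := by simp
  rw [h1, h2, norm_sub_sq_real, real_inner_comm]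
  ring

/-- Some circle through three points of `S` encloses all of `S`. -/
theorem exists_enclosing_circle {S : Finset Plane} (hS : InGeneralPosition S) (h3 : 3 ≤ S.card) :
    ∃ T ∈ S.powersetCard 3, ∃ x r, (∀ p ∈ T, dist p x = r) ∧ ∀ p ∈ S, dist p x ≤ r := by
  classical
  -- The circle about the origin through a farthest point `a` encloses `S`. Its centre moves along
  -- the line through the origin and `a` until a second point `b` is on the circle.
  obtain ⟨a, haS, ha⟩ := S.exists_max_image (fun p => ‖p‖) (Finset.card_pos.1 (by omega))
  obtain ⟨t, ht, b, hbS, hb0, hbt⟩ := exists_tight S (fun p => ‖p - a‖ ^ 2)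
    (fun p => -(2 * inner ℝ (-a) (p - a))) 1 (fun p hp => by
      have h1 := dist_sq_sub_dist_sq p a (-a)
      have h2 := pow_le_pow_left₀ (norm_nonneg _) (ha p hp) 2
      simp only [add_neg_cancel, dist_zero_right] at h1
      linarith) (by
      obtain ⟨p, hp, hpa⟩ := Finset.exists_mem_ne (by omega : 1 < S.card) a
      refine ⟨p, hp, fun h0 => ?_⟩
      have h1 := dist_sq_sub_dist_sq p a (-a)
      have h2 := pow_le_pow_left₀ (norm_nonneg _) (ha p hp) 2
      simp only [add_neg_cancel, dist_zero_right] at h1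
      have h3 : 0 < ‖p - a‖ := norm_pos_iff.2 (sub_ne_zero.2 hpa)
      nlinarith)
  have hba : b ≠ a := by
    rintro rfl
    simp at hb0
  set u : Plane := t • (-a) with hu
  set n : Plane := !₂[-(b - a) 1, (b - a) 0] with hn
  have hnb : inner ℝ n (b - a) = 0 := by
    simp [hn, PiLp.inner_apply, Fin.sum_univ_two]
    ring
  have hn0 : n ≠ 0 := by
    intro h0
    apply hba
    have e0 := congrArg (fun v : Plane => v 0) h0
    have e1 := congrArg (fun v : Plane => v 1) h0
    simp [hn] at e0 e1
    ext i
    fin_cases i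
    · simp; linarith
    · simp; linarith
  have hu' : ∀ p : Plane, ‖p - a‖ ^ 2 + -(2 * inner ℝ (-a) (p - a)) * t
      = ‖p - a‖ ^ 2 - 2 * inner ℝ u (p - a) := by
    intro p
    rw [hu, real_inner_smul_left]
    ring
  -- Moving the centre along the bisector of `a` and `b` keeps both on the circle, until a third
  -- point is hit; were no constraint to vary, `S` would lie on the line `ab`.
  obtain ⟨t', ht', c, hcS, hc0, hct⟩ := exists_tight S
    (fun p => ‖p - a‖ ^ 2 - 2 * inner ℝ u (p - a)) (fun p => -(2 * inner ℝ n (p - a))) 0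
    (fun p hp => by
      have := ht p hp
      rw [hu'] at this
      simpa using this) (by
      by_contra! hall
      obtain ⟨c, hc, hcab⟩ : ∃ c ∈ S, c ∉ ({a, b} : Finset Plane) :=
        Finset.exists_mem_notMem_of_card_lt_card (lt_of_le_of_lt Finset.card_le_two (by omega))
      simp only [Finset.mem_insert, Finset.mem_singleton, not_or] at hcab
      refine hS.1 {a, b, c} (by intro p; simp; rintro (rfl | rfl | rfl) <;> assumption)
        (Finset.card_eq_three.2 ⟨a, b, c, hba.symm, Ne.symm hcab.1, Ne.symm hcab.2, rfl⟩) ?_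
      refine collinear_of_inner_eq_zero (a := a) (by simp) hn0 fun p hp => ?_
      have hpS : p ∈ S := by
        simp at hp
        rcases hp with rfl | rfl | rfl <;> assumption
      simpa using hall p hpS)
  have hca : c ≠ a := by
    rintro rfl
    simp at hc0
  have hcb : c ≠ b := by
    rintro rfl
    simp [hnb] at hc0
  have hu'' : ∀ p : Plane, ‖p - a‖ ^ 2 - 2 * inner ℝ u (p - a) + -(2 * inner ℝ n (p - a)) * t'
      = dist p (a + (u + t' • n)) ^ 2 - dist a (a + (u + t' • n)) ^ 2 := by
    intro p
    rw [dist_sq_sub_dist_sq, inner_add_left, real_inner_smul_left n (p - a) t']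
    ring
  refine ⟨{a, b, c}, Finset.mem_powersetCard.2
    ⟨by intro p; simp; rintro (rfl | rfl | rfl) <;> assumption,
      Finset.card_eq_three.2 ⟨a, b, c, hba.symm, hca.symm, hcb.symm, rfl⟩⟩,
    a + (u + t' • n), dist a (a + (u + t' • n)), fun p hp => ?_, fun p hp => ?_⟩
  · simp only [Finset.mem_insert, Finset.mem_singleton] at hp
    rcases hp with rfl | rfl | rfl
    · rfl
    · rw [← sq_eq_sq₀ dist_nonneg dist_nonneg, ← sub_eq_zero, ← hu'', hnb, ← hu', hbt]
      simp
    · rw [← sq_eq_sq₀ dist_nonneg dist_nonneg, ← sub_eq_zero, ← hu'', hct]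
  · rw [← sq_le_sq₀ dist_nonneg dist_nonneg, ← sub_nonpos, ← hu'']
    exact ht' p hp

/-! ### Four points: enclosed points and crossings -/

/-- An affine dependency with two negative and two positive weights gives crossing segments. -/
theorem exists_crossing_of_weights {a b c d : Plane} {l : Plane → ℝ}
    (ha : l a < 0) (hb : l b < 0) (hc : 0 < l c) (hd : 0 < l d)
    (h0 : l a + l b + (l c + l d) = 0)
    (h1 : l a • a + l b • b + (l c • c + l d • d) = 0) :
    (openSegment ℝ a b ∩ openSegment ℝ c d).Nonempty := by
  have hs : 0 < l c + l d := by linarith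
  have hab : l a + l b = -(l c + l d) := by linarith
  refine ⟨(l c / (l c + l d)) • c + (l d / (l c + l d)) • d, ?_,
    ⟨l c / (l c + l d), l d / (l c + l d), by positivity, by positivity, by field_simp, rfl⟩⟩
  refine ⟨-l a / (l c + l d), -l b / (l c + l d), div_pos (by linarith) hs,
    div_pos (by linarith) hs, by field_simp; linarith, ?_⟩
  have h2 : l c • c + l d • d = -(l a • a + l b • b) := by
    rw [eq_neg_iff_add_eq_zero, add_comm, h1]
  have h3 := congrArg (fun v => (l c + l d)⁻¹ • v) h2
  simp only [smul_add, smul_neg, smul_smul] at h3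
  rw [div_eq_inv_mul, div_eq_inv_mul, div_eq_inv_mul, div_eq_inv_mul, h3]
  simp only [mul_neg, neg_smul]
  abel

open Classical in
/-- Among four points in general position at most two lie inside the circle through the other
three, and if there are two then two of the edges spanned by the points cross. -/
theorem card_inside_of_card_eq_four {Q : Finset Plane} (hQ : InGeneralPosition Q)
    (h4 : Q.card = 4) :
    (Q.filter fun q => dist q (circumcircle (Q.erase q)).center <
      (circumcircle (Q.erase q)).radius).card ≤ 1 ∨
    ((Q.filter fun q => dist q (circumcircle (Q.erase q)).center <
      (circumcircle (Q.erase q)).radius).card ≤ 2 ∧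
      ∃ a b c d : Plane, a ≠ b ∧ c ≠ d ∧ a ≠ c ∧ a ≠ d ∧ Q = {a, b} ∪ {c, d} ∧
        (openSegment ℝ a b ∩ openSegment ℝ c d).Nonempty) := by
  obtain ⟨l₀, hl₀1, hl₀0, q₀, hq₀, hlq₀⟩ :=
    Module.exists_nontrivial_relation_sum_zero_of_finrank_succ_lt_card (R := ℝ) (t := Q)
      (by rw [h4]; simp)
  -- The power of `p` with respect to a circle differs from `‖p‖ ^ 2` by an affine function, which
  -- an affine dependency kills.
  have hdist : ∀ l : Plane → ℝ, ∑ p ∈ Q, l p • p = 0 → ∑ p ∈ Q, l p = 0 → ∀ (x : Plane) (r : ℝ),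
      ∑ p ∈ Q, l p * (dist p x ^ 2 - r ^ 2) = ∑ p ∈ Q, l p * ‖p‖ ^ 2 := by
    intro l h1 h0 x r
    have e : ∀ p : Plane, l p * (dist p x ^ 2 - r ^ 2) =
        l p * ‖p‖ ^ 2 - 2 * inner ℝ (l p • p) x + l p * (‖x‖ ^ 2 - r ^ 2) := by
      intro p
      rw [dist_eq_norm, norm_sub_sq_real, real_inner_smul_left]
      ring
    rw [Finset.sum_congr rfl fun p _ => e p, Finset.sum_add_distrib, Finset.sum_sub_distrib,
      ← Finset.mul_sum, ← sum_inner, ← Finset.sum_mul, h1, h0]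
    simp
  have herase : ∀ q ∈ Q, Q.erase q ∈ Q.powersetCard 3 := fun q hq =>
    Finset.mem_powersetCard.2 ⟨Finset.erase_subset _ _, by rw [Finset.card_erase_of_mem hq, h4]⟩
  have hon : ∀ q ∈ Q, ∀ p ∈ Q.erase q, dist p (circumcircle (Q.erase q)).center =
      (circumcircle (Q.erase q)).radius := fun q hq p hp =>
    dist_circumcircle (Finset.mem_powersetCard.1 (herase q hq)).2
      (hQ.not_collinear (herase q hq)) hp
  -- For the circle through the other three points only the term of `q` survives, so weight times
  -- power is the same for all `q`. With this constant made positive, `q` is inside exactly when its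
  -- weight is negative.
  have hpow : ∀ l : Plane → ℝ, ∑ p ∈ Q, l p • p = 0 → ∑ p ∈ Q, l p = 0 → ∀ q ∈ Q,
      l q * (dist q (circumcircle (Q.erase q)).center ^ 2 - (circumcircle (Q.erase q)).radius ^ 2)
        = ∑ p ∈ Q, l p * ‖p‖ ^ 2 := by
    intro l h1 h0 q hq
    rw [← hdist l h1 h0 (circumcircle (Q.erase q)).center (circumcircle (Q.erase q)).radius,
      ← Finset.add_sum_erase Q _ hq, Finset.sum_eq_zero, add_zero]
    intro p hp
    rw [hon q hq p hp, sub_self, mul_zero]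
  have hradius : ∀ q ∈ Q, 0 ≤ (circumcircle (Q.erase q)).radius := by
    intro q hq
    obtain ⟨p, hp⟩ : (Q.erase q).Nonempty := Finset.card_pos.1 (by
      rw [(Finset.mem_powersetCard.1 (herase q hq)).2]; norm_num)
    rw [← hon q hq p hp]
    exact dist_nonneg
  have hne : ∑ p ∈ Q, l₀ p * ‖p‖ ^ 2 ≠ 0 := by
    rw [← hpow l₀ hl₀1 hl₀0 q₀ hq₀]
    refine mul_ne_zero hlq₀ fun h => hQ.2 Q subset_rfl h4
      ⟨(circumcircle (Q.erase q₀)).center, (circumcircle (Q.erase q₀)).radius, fun p hp => ?_⟩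
    by_cases hpq : p = q₀
    · rw [hpq, ← sq_eq_sq₀ dist_nonneg (hradius q₀ hq₀)]
      linarith
    · exact hon q₀ hq₀ p (Finset.mem_erase.2 ⟨hpq, hp⟩)
  obtain ⟨l, hl1, hl0, hpos⟩ : ∃ l : Plane → ℝ, ∑ p ∈ Q, l p • p = 0 ∧ ∑ p ∈ Q, l p = 0 ∧
      0 < ∑ p ∈ Q, l p * ‖p‖ ^ 2 := by
    rcases hne.lt_or_gt with h | h
    · exact ⟨fun p => -l₀ p, by simp [hl₀1], by simp [hl₀0], by simpa using h⟩
    · exact ⟨l₀, hl₀1, hl₀0, h⟩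
  have hl : ∀ q ∈ Q, l q ≠ 0 := by
    intro q hq h
    rw [← hpow l hl1 hl0 q hq, h, zero_mul] at hpos
    exact hpos.false
  have hfilter : (Q.filter fun q => dist q (circumcircle (Q.erase q)).center <
      (circumcircle (Q.erase q)).radius) = Q.filter fun q => l q < 0 := by
    refine Finset.filter_congr fun q hq => ?_
    rw [← sq_lt_sq₀ dist_nonneg (hradius q hq), ← sub_neg]
    rw [← hpow l hl1 hl0 q hq] at hpos
    rcases mul_pos_iff.1 hpos with h | h
    · exact iff_of_false (by linarith [h.2]) (by linarith [h.1])
    · exact iff_of_true h.2 h.1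
  rw [hfilter]
  have hle : (Q.filter fun q => l q < 0).card ≤ 2 := by
    by_contra! h
    have hcard : (Q.filter fun q => ¬ l q < 0).card ≤ 1 := by
      have := Finset.card_filter_add_card_filter_not (s := Q) (fun q => l q < 0)
      omega
    obtain ⟨q, hq⟩ := Finset.card_le_one_iff_subset_singleton.1 hcard
    -- With `q` the only possible nonnegative weight, powers with respect to the point circle at `q`
    -- make the positive constant nonpositive.
    have h1 := hdist l hl1 hl0 q 0
    have h2 : ∑ p ∈ Q, l p * (dist p q ^ 2 - 0 ^ 2) ≤ 0 := by
      refine Finset.sum_nonpos fun p hp => ?_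
      by_cases hlp : l p < 0
      · exact mul_nonpos_of_nonpos_of_nonneg hlp.le (by simp)
      · have : p = q := by simpa using hq (Finset.mem_filter.2 ⟨hp, hlp⟩)
        simp [this]
    linarith
  rcases Nat.lt_or_ge (Q.filter fun q => l q < 0).card 2 with h | h
  · exact Or.inl (by omega)
  refine Or.inr ⟨hle, ?_⟩
  have hneg : (Q.filter fun q => l q < 0).card = 2 := le_antisymm hle h
  have hnonneg : (Q.filter fun q => ¬ l q < 0).card = 2 := by
    have := Finset.card_filter_add_card_filter_not (s := Q) (fun q => l q < 0)
    omega
  obtain ⟨a, b, hab, hN⟩ := Finset.card_eq_two.1 hneg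
  obtain ⟨c, d, hcd, hP⟩ := Finset.card_eq_two.1 hnonneg
  have hmemN : ∀ p, p ∈ ({a, b} : Finset Plane) → l p < 0 := fun p hp => by
    rw [← hN] at hp
    exact (Finset.mem_filter.1 hp).2
  have hmemP : ∀ p, p ∈ ({c, d} : Finset Plane) → 0 < l p := fun p hp => by
    rw [← hP, Finset.mem_filter] at hp
    exact lt_of_le_of_ne (not_lt.1 hp.2) (hl p hp.1).symm
  have ha := hmemN a (by simp)
  have hb := hmemN b (by simp)
  have hc := hmemP c (by simp)
  have hd := hmemP d (by simp)
  have hQe : Q = {a, b} ∪ {c, d} := by rw [← hN, ← hP, Finset.filter_union_filter_not_eq]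
  refine ⟨a, b, c, d, hab, hcd, fun h => ?_, fun h => ?_, hQe,
    exists_crossing_of_weights ha hb hc hd ?_ ?_⟩
  · rw [h] at ha
    linarith
  · rw [h] at ha
    linarith
  · rw [← hl0, ← Finset.sum_filter_add_sum_filter_not Q (fun q => l q < 0), hN, hP,
      Finset.sum_pair hab, Finset.sum_pair hcd]
  · rw [← hl1, ← Finset.sum_filter_add_sum_filter_not Q (fun q => l q < 0), hN, hP,
      Finset.sum_pair hab, Finset.sum_pair hcd]

/-! ### Voronoi vertices as circumcentres -/

open Classical in
/-- The number of points of `S` strictly inside the circumcircle of `T`. -/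
noncomputable def enclosedCard (S T : Finset Plane) : ℕ :=
  (S.filter fun p => dist p (circumcircle T).center < (circumcircle T).radius).card

theorem InGeneralPosition.filter_dist_eq {S T : Finset Plane} (hS : InGeneralPosition S)
    (hT : T ∈ S.powersetCard 3) {x : Plane} {r : ℝ} (h : ∀ p ∈ T, dist p x = r) :
    (S.filter fun p => dist p x = r) = T := by
  refine (Finset.eq_of_subset_of_card_le (fun p hp => ?_) ?_).symm
  · exact Finset.mem_filter.2 ⟨(Finset.mem_powersetCard.1 hT).1 hp, h p hp⟩
  · rw [(Finset.mem_powersetCard.1 hT).2]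
    exact hS.card_filter_dist_eq_le x r

theorem InGeneralPosition.dist_circumcircle {S T : Finset Plane} (hS : InGeneralPosition S)
    (hT : T ∈ S.powersetCard 3) {p : Plane} (hp : p ∈ T) :
    dist p (circumcircle T).center = (circumcircle T).radius :=
  _root_.dist_circumcircle (Finset.mem_powersetCard.1 hT).2 (hS.not_collinear hT) hp

theorem card_filter_dist_le_eq (S : Finset Plane) (x : Plane) (r : ℝ) :
    (S.filter fun p => dist p x ≤ r).card =
      (S.filter fun p => dist p x < r).card + (S.filter fun p => dist p x = r).card := by
  classical
  rw [← Finset.card_union_of_disjoint]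
  · congr 1
    ext p
    simp only [Finset.mem_filter, Finset.mem_union, le_iff_lt_or_eq]
    tauto
  · rw [Finset.disjoint_filter]
    intro p _ h1 h2
    linarith

theorem InGeneralPosition.enclosedCard_add_three {S T : Finset Plane} (hS : InGeneralPosition S)
    (hT : T ∈ S.powersetCard 3) : enclosedCard S T + 3 =
      (S.filter fun p => dist p (circumcircle T).center ≤ (circumcircle T).radius).card := by
  rw [card_filter_dist_le_eq, hS.filter_dist_eq hT fun p hp => hS.dist_circumcircle hT hp,
    (Finset.mem_powersetCard.1 hT).2, enclosedCard]

theorem InGeneralPosition.enclosedCard_add_three_le {S T : Finset Plane}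
    (hS : InGeneralPosition S) (hT : T ∈ S.powersetCard 3) : enclosedCard S T + 3 ≤ S.card := by
  rw [hS.enclosedCard_add_three hT]
  exact Finset.card_filter_le _ _

-- The cells meeting at the centre come from the enclosed points together with one or two points of
-- `T`; either way there are three choices.
open Classical in
theorem InGeneralPosition.mem_voronoiVertices_of_circle {S T : Finset Plane}
    (hS : InGeneralPosition S) (hT : T ∈ S.powersetCard 3) {k : ℕ} (h1 : enclosedCard S T < k)
    (h2 : k < enclosedCard S T + 3) : (circumcircle T).center ∈ voronoiVertices S k := by
  set x := (circumcircle T).center with hx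
  set r := (circumcircle T).radius with hr
  set I := S.filter fun p => dist p x < r with hI
  have hIc : I.card = enclosedCard S T := rfl
  have hTS := (Finset.mem_powersetCard.1 hT).1
  have hT3 := (Finset.mem_powersetCard.1 hT).2
  have hTr : ∀ p ∈ T, dist p x = r := fun p hp => hS.dist_circumcircle hT hp
  have hIT : Disjoint I T := Finset.disjoint_left.2 fun p hp hpT => by
    have := (Finset.mem_filter.1 hp).2
    rw [hTr p hpT] at this
    exact this.false
  have hcell : ∀ U ⊆ T, x ∈ voronoiCell S (I ∪ U) := by
    intro U hU a ha b hb hbU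
    rw [dist_comm x a, dist_comm x b]
    have hb' : r ≤ dist b x := by
      by_contra! h
      exact hbU (Finset.mem_union_left _ (Finset.mem_filter.2 ⟨hb, h⟩))
    refine le_trans ?_ hb'
    rcases Finset.mem_union.1 ha with h | h
    · exact (Finset.mem_filter.1 h).2.le
    · exact (hTr a (hU h)).le
  have hinj : Set.InjOn (fun U => I ∪ U) (T.powersetCard (k - I.card) : Set (Finset Plane)) := by
    intro U hU V hV hUV
    have hU' := (Finset.mem_powersetCard.1 (Finset.mem_coe.1 hU)).1
    have hV' := (Finset.mem_powersetCard.1 (Finset.mem_coe.1 hV)).1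
    have e := congrArg (fun W => W \ I) hUV
    simp only [Finset.union_sdiff_left] at e
    rwa [Finset.sdiff_eq_self_of_disjoint (hIT.mono_right hU').symm,
      Finset.sdiff_eq_self_of_disjoint (hIT.mono_right hV').symm] at e
  have hcard : (T.powersetCard (k - I.card)).card = 3 := by
    rw [Finset.card_powersetCard, hT3]
    obtain h | h : k - I.card = 1 ∨ k - I.card = 2 := by omega
    all_goals rw [h]; rfl
  rw [voronoiVertices, Set.mem_ofPred_eq, ← hcard, ← Finset.card_image_of_injOn hinj]
  refine Finset.card_le_card fun A hA => ?_
  obtain ⟨U, hU, rfl⟩ := Finset.mem_image.1 hA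
  obtain ⟨hU1, hU2⟩ := Finset.mem_powersetCard.1 hU
  refine Finset.mem_filter.2 ⟨Finset.mem_powersetCard.2 ⟨?_, ?_⟩, hcell U hU1⟩
  · exact Finset.union_subset (Finset.filter_subset _ _) (hU1.trans hTS)
  · rw [Finset.card_union_of_disjoint (hIT.mono_right hU1), hU2]
    omega

-- Two distinct cells at `x` determine a radius `r` such that each nearest `k`-set contains the open
-- disk's points, lies in the closed disk, and is completed by points of the circle. Two points on
-- the circle would allow only two completions.
open Classical in
theorem InGeneralPosition.exists_circle_of_mem_voronoiVertices {S : Finset Plane}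
    (hS : InGeneralPosition S) {k : ℕ} {x : Plane} (h : x ∈ voronoiVertices S k) :
    ∃ T ∈ S.powersetCard 3, (enclosedCard S T < k ∧ k < enclosedCard S T + 3) ∧
      (circumcircle T).center = x := by
  rw [voronoiVertices, Set.mem_ofPred_eq] at h
  set F := (S.powersetCard k).filter fun A => x ∈ voronoiCell S A with hF
  have hFS : ∀ A ∈ F, A ⊆ S := fun A hA =>
    (Finset.mem_powersetCard.1 (Finset.mem_filter.1 hA).1).1
  have hFk : ∀ A ∈ F, A.card = k := fun A hA =>
    (Finset.mem_powersetCard.1 (Finset.mem_filter.1 hA).1).2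
  have hFc : ∀ A ∈ F, ∀ a ∈ A, ∀ b ∈ S, b ∉ A → dist a x ≤ dist b x := by
    intro A hA a ha b hb hbA
    rw [dist_comm a, dist_comm b]
    exact (Finset.mem_filter.1 hA).2 a ha b hb hbA
  obtain ⟨A, hA, A', hA', hne⟩ := Finset.one_lt_card.1 (by omega : 1 < F.card)
  have hdiff : ∀ A ∈ F, ∀ A' ∈ F, A ≠ A' → ∃ a ∈ A, a ∉ A' := by
    intro A hA A' hA' hne
    by_contra! hsub
    exact hne (Finset.eq_of_subset_of_card_le hsub (by rw [hFk A hA, hFk A' hA']))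
  obtain ⟨a, haA, haA'⟩ := hdiff A hA A' hA' hne
  obtain ⟨a', haA2, haA2'⟩ := hdiff A' hA' A hA hne.symm
  set r := dist a x with hr
  have hr' : dist a' x = r := le_antisymm
    (hFc A' hA' a' haA2 a (hFS A hA haA) haA') (hFc A hA a haA a' (hFS A' hA' haA2) haA2')
  set I := S.filter fun p => dist p x < r with hI
  set E := S.filter fun p => dist p x = r with hE
  set B := S.filter fun p => dist p x ≤ r with hB
  have hBcard : B.card = I.card + E.card := card_filter_dist_le_eq S x r
  have hIk : I.card < k := by
    rw [← hFk A hA]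
    refine Finset.card_lt_card ((Finset.ssubset_iff_of_subset fun p hp => ?_).2 ⟨a, haA, ?_⟩)
    · by_contra hpA
      obtain ⟨hpS, hpr⟩ := Finset.mem_filter.1 hp
      linarith [hFc A hA a haA p hpS hpA]
    · simp [hI, hr]
  have hkB : k < B.card := by
    rw [← hFk A hA]
    refine Finset.card_lt_card ((Finset.ssubset_iff_of_subset fun p hp => ?_).2 ⟨a', ?_, haA2'⟩)
    · exact Finset.mem_filter.2 ⟨hFS A hA hp,
        (hFc A hA p hp a' (hFS A' hA' haA2) haA2').trans hr'.le⟩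
    · exact Finset.mem_filter.2 ⟨hFS A' hA' haA2, hr'.le⟩
  have hIsub : ∀ D ∈ F, I ⊆ D := by
    intro D hD p hp
    by_contra hpD
    obtain ⟨hpS, hpr⟩ := Finset.mem_filter.1 hp
    obtain ⟨q, hqD, hqI⟩ := Finset.exists_mem_notMem_of_card_lt_card ((hFk D hD).symm ▸ hIk)
    have h1 : r ≤ dist q x := by
      by_contra! h
      exact hqI (Finset.mem_filter.2 ⟨hFS D hD hqD, h⟩)
    linarith [hFc D hD q hqD p hpS hpD]
  have hsubB : ∀ D ∈ F, D ⊆ B := by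
    intro D hD p hp
    obtain ⟨q, hqB, hqD⟩ := Finset.exists_mem_notMem_of_card_lt_card ((hFk D hD).symm ▸ hkB)
    obtain ⟨hqS, hqr⟩ := Finset.mem_filter.1 hqB
    exact Finset.mem_filter.2 ⟨hFS D hD hp, (hFc D hD p hp q hqS hqD).trans hqr⟩
  have hdecomp : ∀ D ∈ F, D \ I ∈ E.powersetCard (k - I.card) := by
    intro D hD
    refine Finset.mem_powersetCard.2 ⟨fun p hp => ?_, ?_⟩
    · obtain ⟨hpD, hpI⟩ := Finset.mem_sdiff.1 hp
      obtain ⟨hpS, hpr⟩ := Finset.mem_filter.1 (hsubB D hD hpD)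
      refine Finset.mem_filter.2 ⟨hpS, hpr.eq_or_lt.resolve_right fun h => hpI ?_⟩
      exact Finset.mem_filter.2 ⟨hpS, h⟩
    · rw [Finset.card_sdiff_of_subset (hIsub D hD), hFk D hD]
  have hFle : F.card ≤ (E.powersetCard (k - I.card)).card := by
    refine Finset.card_le_card_of_injOn (fun D => D \ I) hdecomp ?_
    intro D hD D' hD' e
    have e' : D \ I = D' \ I := e
    rw [← Finset.sdiff_union_of_subset (hIsub D hD), e',
      Finset.sdiff_union_of_subset (hIsub D' hD')]
  rw [Finset.card_powersetCard] at hFle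
  have hE3 : E.card ≤ 3 := hS.card_filter_dist_eq_le x r
  have hE3' : E.card = 3 := by
    by_contra hE'
    have h2 : E.card = 2 := by omega
    have h1 : k - I.card = 1 := by omega
    rw [h2, h1] at hFle
    simp at hFle
    omega
  have hET : E ∈ S.powersetCard 3 := Finset.mem_powersetCard.2 ⟨Finset.filter_subset _ _, hE3'⟩
  have hcirc : circumcircle E = ⟨x, r⟩ :=
    eq_circumcircle hE3' (hS.not_collinear hET) fun p hp => (Finset.mem_filter.1 hp).2
  have hcount : enclosedCard S E = I.card := by rw [enclosedCard, hcirc]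
  exact ⟨E, hET, by omega, by rw [hcirc]⟩

open Classical in
/-- The vertices of the order-`k` Voronoi diagram correspond to the circles through three points of
`S` that enclose `k - 1` or `k - 2` points of `S`. -/
theorem InGeneralPosition.ncard_voronoiVertices {S : Finset Plane} (hS : InGeneralPosition S)
    (k : ℕ) : (voronoiVertices S k).ncard = ((S.powersetCard 3).filter fun T =>
      enclosedCard S T < k ∧ k < enclosedCard S T + 3).card := by
  have himage : voronoiVertices S k = (fun T => (circumcircle T).center) ''
      ((S.powersetCard 3).filter fun T =>
        enclosedCard S T < k ∧ k < enclosedCard S T + 3 : Finset (Finset Plane)) := by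
    ext x
    constructor
    · intro hx
      obtain ⟨T, hT, hk, hTx⟩ := hS.exists_circle_of_mem_voronoiVertices hx
      exact ⟨T, Finset.mem_coe.2 (Finset.mem_filter.2 ⟨hT, hk⟩), hTx⟩
    · rintro ⟨T, hT, rfl⟩
      obtain ⟨hT, h1, h2⟩ := Finset.mem_filter.1 (Finset.mem_coe.1 hT)
      exact hS.mem_voronoiVertices_of_circle hT h1 h2
  -- Of two concentric circles the larger encloses at least three more points, but the counts
  -- allowed for `k` differ by at most one.
  have hrad : ∀ T ∈ S.powersetCard 3, ∀ T' ∈ S.powersetCard 3, enclosedCard S T < k →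
      k < enclosedCard S T' + 3 → (circumcircle T).center = (circumcircle T').center →
      (circumcircle T).radius ≤ (circumcircle T').radius := by
    intro T hT T' hT' h1 h2 hc
    by_contra! hlt
    have : enclosedCard S T' + 3 ≤ enclosedCard S T := by
      rw [hS.enclosedCard_add_three hT', enclosedCard, hc]
      exact Finset.card_le_card
        (Finset.monotone_filter_right _ fun p _ hp => lt_of_le_of_lt hp hlt)
    omega
  rw [himage, Set.InjOn.ncard_image, Set.ncard_coe_finset]
  intro T hT T' hT' hc
  obtain ⟨hT, h1, h2⟩ := Finset.mem_filter.1 (Finset.mem_coe.1 hT)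
  obtain ⟨hT', h1', h2'⟩ := Finset.mem_filter.1 (Finset.mem_coe.1 hT')
  have hr := le_antisymm (hrad T hT T' hT' h1 h2' hc) (hrad T' hT' T hT h1' h2 hc.symm)
  have hc' : (circumcircle T).center = (circumcircle T').center := hc
  rw [← hS.filter_dist_eq hT fun p hp => hS.dist_circumcircle hT hp, hc', hr,
    hS.filter_dist_eq hT' fun p hp => hS.dist_circumcircle hT' hp]

/-! ### The circle polynomial -/

open Polynomial in
/-- The polynomial whose coefficient at `X ^ k` is the number of circles through three points of
`S` that enclose exactly `k` points of `S`. -/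
noncomputable def circlePolynomial (S : Finset Plane) : ℝ[X] :=
  ∑ T ∈ S.powersetCard 3, X ^ enclosedCard S T

-- A triple enclosing `e` points contributes `X ^ e + X ^ (e + 1)`; both orders `e + 1`, `e + 2` are
-- in range because `e + 3 ≤ n`.
open Polynomial in
theorem InGeneralPosition.voronoiPolynomial_eq {S : Finset Plane} (hS : InGeneralPosition S) :
    voronoiPolynomial S = (1 + X) * (circlePolynomial S).map (algebraMap ℝ ℂ) := by
  classical
  have hterm : ∀ k, C (((voronoiVertices S k).ncard : ℕ) : ℂ) * X ^ (k - 1) =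
      ∑ T ∈ S.powersetCard 3, if enclosedCard S T < k ∧ k < enclosedCard S T + 3 then
        (X : ℂ[X]) ^ (k - 1) else 0 := by
    intro k
    rw [← Finset.sum_filter, Finset.sum_const, hS.ncard_voronoiVertices, nsmul_eq_mul]
    simp
  rw [voronoiPolynomial, Finset.sum_congr rfl fun k _ => hterm k, Finset.sum_comm,
    circlePolynomial, Polynomial.map_sum, Finset.mul_sum]
  refine Finset.sum_congr rfl fun T hT => ?_
  have hle := hS.enclosedCard_add_three_le hT
  have hset : (Finset.Icc 1 (S.card - 1)).filter
      (fun k => enclosedCard S T < k ∧ k < enclosedCard S T + 3) =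
        {enclosedCard S T + 1, enclosedCard S T + 2} := by
    ext k
    simp only [Finset.mem_filter, Finset.mem_Icc, Finset.mem_insert, Finset.mem_singleton]
    omega
  rw [← Finset.sum_filter, hset, Finset.sum_pair (by omega), Polynomial.map_pow, map_X]
  simp only [Nat.add_sub_cancel, show enclosedCard S T + 2 - 1 = enclosedCard S T + 1 by omega]
  ring

theorem circlePolynomial_coeff_nonneg (S : Finset Plane) (k : ℕ) :
    0 ≤ (circlePolynomial S).coeff k := by
  rw [circlePolynomial, Polynomial.finsetSum_coeff]
  refine Finset.sum_nonneg fun T _ => ?_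
  rw [Polynomial.coeff_X_pow]
  positivity

theorem circlePolynomial_eval_one (S : Finset Plane) :
    (circlePolynomial S).eval 1 = (S.card.choose 3 : ℝ) := by
  simp [circlePolynomial, Polynomial.eval_finsetSum]

theorem circlePolynomial_derivative_eval_one (S : Finset Plane) :
    (circlePolynomial S).derivative.eval 1 = ∑ T ∈ S.powersetCard 3, (enclosedCard S T : ℝ) := by
  simp [circlePolynomial, Polynomial.eval_finsetSum, Polynomial.derivative_X_pow]

/-- The top coefficient is positive because an enclosing circle has all other `n - 3` points inside.
-/
theorem InGeneralPosition.natDegree_circlePolynomial {S : Finset Plane} (hS : InGeneralPosition S)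
    (h3 : 3 ≤ S.card) : (circlePolynomial S).natDegree = S.card - 3 := by
  refine Polynomial.natDegree_eq_of_le_of_coeff_ne_zero ?_ (ne_of_gt ?_)
  · refine Polynomial.natDegree_sum_le_of_forall_le _ _ fun T hT => ?_
    rw [Polynomial.natDegree_X_pow]
    have := hS.enclosedCard_add_three_le hT
    omega
  · obtain ⟨T, hT, x, r, hTr, hle⟩ := exists_enclosing_circle hS h3
    rw [circlePolynomial, Polynomial.finsetSum_coeff]
    refine Finset.sum_pos' (fun T _ => ?_) ⟨T, hT, ?_⟩
    · rw [Polynomial.coeff_X_pow]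
      positivity
    · have hc : circumcircle T = ⟨x, r⟩ :=
        eq_circumcircle (Finset.mem_powersetCard.1 hT).2 (hS.not_collinear hT) hTr
      have := hS.enclosedCard_add_three hT
      rw [hc, Finset.filter_true_of_mem hle] at this
      rw [Polynomial.coeff_X_pow, if_pos (by omega)]
      exact one_pos

/-! ### Counting enclosed points by quadruples -/

theorem InGeneralPosition.mono {S Q : Finset Plane} (hS : InGeneralPosition S) (h : Q ⊆ S) :
    InGeneralPosition Q :=
  ⟨fun T hT => hS.1 T (hT.trans h), fun T hT => hS.2 T (hT.trans h)⟩

-- Double counting: a triple `T` with an enclosed point `p` corresponds to the quadruple `insert p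
-- T` with `p` marked.
open Classical in
theorem InGeneralPosition.sum_enclosedCard {S : Finset Plane} (hS : InGeneralPosition S) :
    ∑ T ∈ S.powersetCard 3, enclosedCard S T = ∑ Q ∈ S.powersetCard 4,
      (Q.filter fun q => dist q (circumcircle (Q.erase q)).center <
        (circumcircle (Q.erase q)).radius).card := by
  simp only [enclosedCard]
  rw [← Finset.card_sigma, ← Finset.card_sigma]
  have hout : ∀ T ∈ S.powersetCard 3, ∀ p, dist p (circumcircle T).center <
      (circumcircle T).radius → p ∉ T := by
    intro T hT p hp hpT
    rw [hS.dist_circumcircle hT hpT] at hp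
    exact hp.false
  refine Finset.card_bij' (fun a _ => ⟨insert a.2 a.1, a.2⟩) (fun a _ => ⟨a.1.erase a.2, a.2⟩)
    ?_ ?_ ?_ ?_
  · rintro ⟨T, p⟩ h
    simp only [Finset.mem_sigma, Finset.mem_filter] at h ⊢
    obtain ⟨hT, hpS, hp⟩ := h
    have hpT := hout T hT p hp
    obtain ⟨hTS, hT3⟩ := Finset.mem_powersetCard.1 hT
    refine ⟨Finset.mem_powersetCard.2 ⟨Finset.insert_subset hpS hTS, ?_⟩,
      Finset.mem_insert_self _ _, ?_⟩
    · rw [Finset.card_insert_of_notMem hpT, hT3]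
    · rwa [Finset.erase_insert hpT]
  · rintro ⟨Q, q⟩ h
    simp only [Finset.mem_sigma, Finset.mem_filter] at h ⊢
    obtain ⟨hQ, hqQ, hq⟩ := h
    obtain ⟨hQS, hQ4⟩ := Finset.mem_powersetCard.1 hQ
    refine ⟨Finset.mem_powersetCard.2 ⟨(Finset.erase_subset _ _).trans hQS, ?_⟩, hQS hqQ, hq⟩
    rw [Finset.card_erase_of_mem hqQ, hQ4]
  · rintro ⟨T, p⟩ h
    simp only [Finset.mem_sigma, Finset.mem_filter] at h
    simp [Finset.erase_insert (hout T h.1 p h.2.2)]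
  · rintro ⟨Q, q⟩ h
    simp only [Finset.mem_sigma, Finset.mem_filter] at h
    simp [Finset.insert_erase h.2.1]

theorem InGeneralPosition.sum_enclosedCard_le {S : Finset Plane} (hS : InGeneralPosition S) :
    ∑ T ∈ S.powersetCard 3, enclosedCard S T ≤
      S.card.choose 4 + rectilinearCrossingNumber S := by
  classical
  set m : Finset Plane → ℕ := fun Q => (Q.filter fun q =>
    dist q (circumcircle (Q.erase q)).center < (circumcircle (Q.erase q)).radius).card with hm
  have hQ : ∀ Q ∈ S.powersetCard 4, m Q ≤ 1 + if 2 ≤ m Q then 1 else 0 := by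
    intro Q hQ
    obtain ⟨hQS, hQ4⟩ := Finset.mem_powersetCard.1 hQ
    split_ifs with h
    · rcases card_inside_of_card_eq_four (hS.mono hQS) hQ4 with h' | ⟨h', -⟩
      · exact le_trans h' (by norm_num)
      · exact h'
    · omega
  rw [hS.sum_enclosedCard]
  refine (Finset.sum_le_sum hQ).trans ?_
  rw [Finset.sum_add_distrib, ← Finset.sum_filter, Finset.sum_const, Finset.sum_const,
    Finset.card_powersetCard, smul_eq_mul, smul_eq_mul, mul_one, mul_one]
  refine Nat.add_le_add_left ?_ _
  rw [rectilinearCrossingNumber]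
  -- The endpoints of a crossing pair recover the quadruple, so distinct quadruples use distinct
  -- crossings.
  refine Finset.card_le_card_of_surjOn (fun P => P.biUnion id) ?_
  intro Q hQ
  obtain ⟨hQ, h2⟩ := Finset.mem_filter.1 (Finset.mem_coe.1 hQ)
  obtain ⟨hQS, hQ4⟩ := Finset.mem_powersetCard.1 hQ
  obtain h' | ⟨-, a, b, c, d, hab, hcd, hac, had, hQe, hcross⟩ :=
    card_inside_of_card_eq_four (hS.mono hQS) hQ4
  · have : m Q ≤ 1 := h'
    omega
  refine ⟨{{a, b}, {c, d}}, Finset.mem_coe.2 (Finset.mem_filter.2 ⟨?_, a, b, c, d, rfl, hcross⟩), ?_⟩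
  · have hne : ({a, b} : Finset Plane) ≠ {c, d} := by
      intro h
      have : a ∈ ({c, d} : Finset Plane) := h ▸ Finset.mem_insert_self a _
      simp [hac, had] at this
    refine Finset.mem_powersetCard.2 ⟨fun e he => ?_, Finset.card_pair hne⟩
    rw [Finset.mem_insert, Finset.mem_singleton] at he
    rcases he with rfl | rfl
    · exact Finset.mem_powersetCard.2
        ⟨(hQe ▸ Finset.subset_union_left).trans hQS, Finset.card_pair hab⟩
    · exact Finset.mem_powersetCard.2
        ⟨(hQe ▸ Finset.subset_union_right).trans hQS, Finset.card_pair hcd⟩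
  · rw [hQe]
    simp [Finset.biUnion_insert]

/-! ### The largest root -/

theorem mainTheorem2 :
    ∃ K : ℝ, ∀ (n : ℕ) (S : Finset Plane) (α : ℝ),
      3 < n → S.card = n → InGeneralPosition S →
      (rectilinearCrossingNumber S : ℝ) = α * (n.choose 4 : ℝ) →
      ∃ z ∈ (voronoiPolynomial S).roots,
        1 + (1 - α) * Real.pi ^ 2 / (16 * ((n : ℝ) - 3) ^ 2) - K / (n : ℝ) ^ 4 ≤ ‖z‖ := by
  -- `256 = 4 ^ 4` makes the error term `1` at `n = 4`, where `d = 1` is too small for the root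
  -- bound and the root `-1` suffices. For `n ≥ 5` no error term is needed.
  refine ⟨256, fun n S α hn hSn hS hcr => ?_⟩
  have hn' : (4 : ℝ) ≤ n := by exact_mod_cast hn
  have hchoose3 : (0 : ℝ) < n.choose 3 := by exact_mod_cast Nat.choose_pos (by omega)
  have hchoose4 : (0 : ℝ) < n.choose 4 := by exact_mod_cast Nat.choose_pos (by omega)
  have hα0 : 0 ≤ α := by
    by_contra! h
    have : α * (n.choose 4 : ℝ) < 0 := mul_neg_of_neg_of_pos h hchoose4
    rw [← hcr] at this
    exact absurd this (not_lt.2 (Nat.cast_nonneg _))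
  have heval : 0 < (circlePolynomial S).eval 1 := by
    rw [circlePolynomial_eval_one, hSn]
    exact hchoose3
  have hC0 : (circlePolynomial S).map (algebraMap ℝ ℂ) ≠ 0 := by
    rw [Polynomial.map_ne_zero_iff (algebraMap ℝ ℂ).injective]
    intro h
    simp [h] at heval
  have hX0 : (1 + Polynomial.X : Polynomial ℂ) ≠ 0 := by
    intro h
    have := congrArg (Polynomial.eval 0) h
    simp at this
  have hV0 := mul_ne_zero hX0 hC0
  rw [hS.voronoiPolynomial_eq]
  have hneg : (-1 : ℂ) ∈
      ((1 + Polynomial.X) * (circlePolynomial S).map (algebraMap ℝ ℂ)).roots := by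
    rw [Polynomial.mem_roots hV0]
    simp [Polynomial.IsRoot]
  have hK : 0 ≤ 256 / (n : ℝ) ^ 4 := by positivity
  rcases le_or_gt 1 α with hα | hα
  · refine ⟨-1, hneg, ?_⟩
    have : (1 - α) * Real.pi ^ 2 / (16 * ((n : ℝ) - 3) ^ 2) ≤ 0 :=
      div_nonpos_of_nonpos_of_nonneg
        (mul_nonpos_of_nonpos_of_nonneg (by linarith) (by positivity)) (by positivity)
    rw [norm_neg, norm_one]
    linarith
  rcases (by omega : n = 4 ∨ 5 ≤ n) with h4 | h5
  · refine ⟨-1, hneg, ?_⟩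
    have hpi : Real.pi ^ 2 < 16 := by nlinarith [Real.pi_lt_four, Real.pi_pos]
    rw [h4, norm_neg, norm_one]
    norm_num
    nlinarith [sq_nonneg Real.pi]
  have hdeg : (circlePolynomial S).natDegree = n - 3 := by
    rw [hS.natDegree_circlePolynomial (by omega), hSn]
  have hdeg' : ((circlePolynomial S).natDegree : ℝ) = n - 3 := by
    rw [hdeg, Nat.cast_sub (by omega)]
    norm_num
  obtain ⟨z, hz, hnorm⟩ := exists_root_norm_ge (circlePolynomial_coeff_nonneg S)
    (by omega) hα0 hα heval (by
      have h1 : (∑ T ∈ S.powersetCard 3, (enclosedCard S T : ℝ)) ≤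
          n.choose 4 + rectilinearCrossingNumber S := by
        rw [← hSn]
        exact_mod_cast hS.sum_enclosedCard_le
      have h2 : (n.choose 4 : ℝ) * 4 = n.choose 3 * ((n : ℝ) - 3) := by
        have := Nat.choose_succ_right_eq n 3
        rw [← hdeg', hdeg]
        exact_mod_cast this
      rw [circlePolynomial_derivative_eval_one, circlePolynomial_eval_one, hdeg', hSn]
      rw [hcr] at h1
      -- `4 * n.choose 4 = (n - 3) * n.choose 3` turns the crossing count into a multiple of `d *
      -- C(1)`.
      linear_combination h1 + (1 + α) / 4 * h2)
  rw [hdeg'] at hnorm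
  refine ⟨z, ?_, by linarith⟩
  rw [Polynomial.roots_mul hV0, Multiset.mem_add]
  exact Or.inr hz
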